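/- Let $\mathcal C$ be the countable set of particle configurations $x_1>x_2>x_3>\cdots$ in $\mathbb Z$ with $x_N=-N$ for all sufficiently large $N$. For $0<q<1$ and $t\ge 0$, let $\mu_t^{(q)}$ be the law on $\mathcal C$ at time $t$ of the continuous-time TASEP with geometric speeds started from the step configuration $x_i(0)=-i$, $i\ge 1$: each particle $x_i$ carries an independent exponential clock of rate $q^{i-1}$, and when it rings the particle jumps to the right by one if the destination is not occupied, while nothing changes otherwise. For $\alpha\in[0,1]$ and $A\in\mathbb Z_{\ge 0}$, let $Y_\alpha(A)$ denote a truncated geometric random variable on $\{0,1,\ldots,A\}$, that is, $\mathrm{Prob}(Y_\alpha(A)=k)=(1-\alpha)\alpha^k$ for $0\le k\le A-1$ and $\mathrm{Prob}(Y_\alpha(A)=A)=\alpha^A$. Let $\mathbf L^{(q)}$ be the Markov map (stochastic matrix) on $\mathcal C$ under which the random image $\hat x_1>\hat x_2>\cdots$ of a configuration $x_1>x_2>\cdots$ in $\mathcal C$ is $$\hat x_i = x_{i+1}+1+Y_{q^i}(x_i-x_{i+1}-1),\qquad i=1,2,\ldots,$$ where the truncated geometric random variables $Y_{q^i}(x_i-x_{i+1}-1)$,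 $i\ge1$, are independent. **Theorem.** For every $q\in(0,1)$ and every $t\ge 0$, $$\mu_t^{(q)}\,\mathbf L^{(q)}=\mu_{qt}^{(q)},$$ that is, $\sum_{\mathbf y\in\mathcal C}\mu_t^{(q)}(\mathbf y)\,\mathbf L^{(q)}(\mathbf y,\mathbf x)=\mu_{qt}^{(q)}(\mathbf x)$ for all $\mathbf x\in\mathcal C$. -/

import Mathlib

open scoped NNReal ENNReal

noncomputable section

/-- A left-packed, right-finite particle configuration on `ℤ`. Particles are numbered from right to
left starting from `0`: `pos i` is the location of the `(i+1)`-st particle from the right. -/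
@[ext]
structure Config where
  pos : ℕ → ℤ
  strictAnti : StrictAnti pos
  packed : ∀ᶠ i in Filter.atTop, pos i = -((i : ℤ) + 1)

namespace Config

/-- The step configuration: the particles occupy exactly the negative integers. -/
def step : Config where
  pos i := -((i : ℤ) + 1)
  strictAnti := fun i j h => by dsimp only; omega
  packed := Filter.Eventually.of_forall fun _ => rfl

/-- The number of holes between particle `i` and its left neighbour, particle `i + 1`. -/
def gap (x : Config) (i : ℕ) : ℕ := (x.pos i - x.pos (i + 1) - 1).toNat

theorem gap_eq (x : Config) (i : ℕ) : (x.gap i : ℤ) = x.pos i - x.pos (i + 1) - 1 := by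
  have := x.strictAnti (Nat.lt_succ_self i)
  unfold gap
  simp only [Nat.succ_eq_add_one] at this
  omega

theorem gap_eventually_zero (x : Config) : ∀ᶠ i in Filter.atTop, x.gap i = 0 := by
  filter_upwards [x.packed, (Filter.tendsto_add_atTop_nat 1).eventually x.packed] with i h1 h2
  have := x.gap_eq i
  push_cast at h2
  omega

open Classical in
/-- What happens when the clock of particle `i` rings: the particle jumps to the right by one if
the destination is not occupied, and nothing changes otherwise. -/
def ring (i : ℕ) (x : Config) : Config :=
  if h : ∃ j, x.pos j = x.pos i + 1 then x
  else
    { pos := Function.update x.pos i (x.pos i + 1)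
      strictAnti := by
        push Not at h
        refine strictAnti_nat_of_succ_lt fun n => ?_
        have h0 := x.strictAnti (Nat.lt_succ_self n)
        simp only [Nat.succ_eq_add_one] at h0
        have h1 := h n
        by_cases a : n = i
        · subst a; simp; omega
        · by_cases b : n + 1 = i
          · subst b; simp; omega
          · simp [a, b, h0]
      packed := by
        filter_upwards [x.packed, Filter.eventually_gt_atTop i] with j hj hij
        rw [Function.update_of_ne (by omega), hj] }

end Config

/-! ### TASEP -/

/-- The particle whose clock rings first, when particle `i` carries an independent exponential
clock of rate `c i`: it is particle `i` with probability `c i / ∑ j, c j`. -/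
def firstRing (c : ℕ → ℝ≥0) (hpos : ∀ i, 0 < c i) (hsum : Summable c) : PMF ℕ :=
  PMF.normalize (fun i => (c i : ℝ≥0∞))
    (fun h => (hpos 0).ne' (by simpa using ENNReal.tsum_eq_zero.1 h 0))
    (ENNReal.tsum_coe_ne_top_iff_summable.2 hsum)

/-- The law of the configuration after `n` rings of the clocks, from the step configuration. -/
def tasepAfter (c : ℕ → ℝ≥0) (hpos : ∀ i, 0 < c i) (hsum : Summable c) : ℕ → PMF Config
  | 0 => PMF.pure Config.step
  | n + 1 => (tasepAfter c hpos hsum n).bind fun x =>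
      (firstRing c hpos hsum).map fun i => x.ring i

/-- The law at time `t` of the continuous-time TASEP with particle speeds `c` (of finite sum) and
step initial configuration. Particle `i` has an independent exponential clock of rate `c i`;
hence the rings of all the clocks together form a Poisson process of rate `∑ i, c i`, so that the
number of rings up to time `t` is Poisson of mean `t * ∑ i, c i`, and independently of this the
successive rings belong to independently chosen particles with the law `firstRing`. That this is
the law of the Markov jump process with the required rates is checked in `tasepLaw_forward`. -/
def tasepLaw (c : ℕ → ℝ≥0) (hpos : ∀ i, 0 < c i) (hsum : Summable c) (t : ℝ≥0) : PMF Config :=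
  (ProbabilityTheory.poissonMeasure (t * ∑' i, c i)).toPMF.bind (tasepAfter c hpos hsum)

theorem tasepLaw_zero (c : ℕ → ℝ≥0) (hpos : ∀ i, 0 < c i) (hsum : Summable c) :
    tasepLaw c hpos hsum 0 = PMF.pure Config.step := by
  have : (ProbabilityTheory.poissonMeasure (0 * ∑' i, c i)).toPMF = PMF.pure 0 := by
    ext n
    rw [MeasureTheory.Measure.toPMF_apply, ProbabilityTheory.poissonMeasure_singleton]
    rcases n with _ | n <;> simp [PMF.pure_apply]
  rw [tasepLaw, this, PMF.pure_bind, tasepAfter]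

/-- The derivative of an exponential generating function with bounded coefficients. -/
theorem hasDerivAt_egf (a : ℕ → ℝ) (ha : ∀ n, |a n| ≤ 1) (s : ℝ) :
    HasDerivAt (fun s : ℝ => ∑' n, s ^ n / n.factorial * a n)
      (∑' n, s ^ n / n.factorial * a (n + 1)) s := by
  have key := hasDerivAt_tsum_of_isPreconnected (𝕜 := ℝ) (F := ℝ) (y₀ := 0) (y := s)
    (t := Metric.ball 0 (|s| + 1)) (u := fun n : ℕ => n * (|s| + 1) ^ (n - 1) / n.factorial)
    (g := fun (n : ℕ) s => s ^ n / n.factorial * a n)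
    (g' := fun (n : ℕ) s => n * s ^ (n - 1) / n.factorial * a n) ?_ Metric.isOpen_ball
    (convex_ball _ _).isPreconnected ?_ ?_ (by simp; positivity) ?_ (by simp)
  · have e : ∀ n : ℕ, ((n + 1 : ℕ) : ℝ) * s ^ (n + 1 - 1) / (n + 1).factorial * a (n + 1)
        = s ^ n / n.factorial * a (n + 1) := fun n => by
      have h1 := n.factorial_ne_zero
      rw [Nat.factorial_succ, Nat.add_sub_cancel]
      push_cast
      field_simp
    refine key.congr_deriv ?_
    rw [tsum_eq_zero_add' (f := fun n : ℕ => (n : ℝ) * s ^ (n - 1) / n.factorial * a n)]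
    · simp only [e]
      simp
    · simp only [e]
      refine Summable.of_norm_bounded (Real.summable_pow_div_factorial |s|) fun n => ?_
      rw [norm_mul, norm_div, norm_pow, Real.norm_eq_abs, Real.norm_natCast, Real.norm_eq_abs]
      exact mul_le_of_le_one_right (by positivity) (ha _)
  · rw [← summable_nat_add_iff 1]
    refine (Real.summable_pow_div_factorial (|s| + 1)).congr fun n => ?_
    have h1 := n.factorial_ne_zero
    rw [Nat.factorial_succ, Nat.add_sub_cancel]
    push_cast
    field_simp
  · intro n y _
    exact ((hasDerivAt_pow n y).div_const _).mul_const _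
  · intro n y hy
    rw [Metric.mem_ball, dist_zero_right] at hy
    rw [norm_mul, norm_div, norm_mul, norm_pow, Real.norm_natCast, Real.norm_natCast]
    refine (mul_le_of_le_one_right (by positivity) (ha _)).trans ?_
    gcongr
  · refine summable_of_ne_finset_zero (s := {0}) fun n hn => ?_
    rw [Finset.mem_singleton] at hn
    simp [hn]

/-- Mixtures over a Poisson number, as exponential generating functions. -/
theorem toPMF_poisson_bind_toReal (r : ℝ≥0) (p : ℕ → PMF Config) (x : Config) :
    (((ProbabilityTheory.poissonMeasure r).toPMF.bind p) x).toReal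
      = Real.exp (-r) * ∑' n, (r : ℝ) ^ n / n.factorial * (p n x).toReal := by
  rw [PMF.bind_apply, ENNReal.tsum_toReal_eq, ← tsum_mul_left]
  · refine tsum_congr fun n => ?_
    rw [MeasureTheory.Measure.toPMF_apply, ProbabilityTheory.poissonMeasure_singleton,
      ENNReal.toReal_mul, ENNReal.toReal_ofReal (by positivity)]
    ring
  · exact fun n => ENNReal.mul_ne_top (PMF.apply_ne_top _ _) (PMF.apply_ne_top _ _)

/-- Kolmogorov's forward equation for the law of TASEP: the clock of particle `i` rings at rate
`c i`, and then `ring i` is applied to the configuration. -/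
theorem tasepLaw_forward (c : ℕ → ℝ≥0) (hpos : ∀ i, 0 < c i) (hsum : Summable c) (x : Config)
    (t : ℝ) (ht : 0 ≤ t) :
    HasDerivWithinAt (fun s : ℝ => (tasepLaw c hpos hsum s.toNNReal x).toReal)
      (∑' i, (c i : ℝ) * ((((tasepLaw c hpos hsum t.toNNReal).map (Config.ring i)) x).toReal
        - (tasepLaw c hpos hsum t.toNNReal x).toReal)) (Set.Ici 0) t := by
  set r : ℝ≥0 := ∑' i, c i with hr
  have hr0 : r ≠ 0 := ((hpos 0).trans_le (hsum.le_tsum 0 fun _ _ => zero_le)).ne'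
  have hre : (r : ℝ≥0∞) = ∑' i, (c i : ℝ≥0∞) := ENNReal.coe_tsum hsum
  set a : ℕ → ℝ := fun n => (tasepAfter c hpos hsum n x).toReal with ha
  have hle : ∀ p : PMF Config, (p x).toReal ≤ 1 := fun p =>
    ENNReal.toReal_le_of_le_ofReal zero_le_one (by simpa using p.coe_le_one x)
  have ha1 : ∀ n, |a n| ≤ 1 := fun n => by
    rw [abs_of_nonneg ENNReal.toReal_nonneg]; exact hle _
  have hf : ∀ s : ℝ, 0 ≤ s → (tasepLaw c hpos hsum s.toNNReal x).toReal
      = Real.exp (-(s * r)) * ∑' n, (s * r) ^ n / n.factorial * a n := fun s hs => by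
    rw [tasepLaw, toPMF_poisson_bind_toReal]
    simp [hr, ha, hs]
  set μ := tasepLaw c hpos hsum t.toNNReal with hμ
  have hν : ∑' i, (c i : ℝ≥0∞) * (μ.map (Config.ring i)) x = r *
      ((ProbabilityTheory.poissonMeasure (t.toNNReal * r)).toPMF.bind
        fun n => tasepAfter c hpos hsum (n + 1)) x := by
    have h1 : ((ProbabilityTheory.poissonMeasure (t.toNNReal * r)).toPMF.bind
        fun n => tasepAfter c hpos hsum (n + 1))
        = (firstRing c hpos hsum).bind fun i => μ.map (Config.ring i) := by
      have h2 : ((firstRing c hpos hsum).bind fun i => μ.map (Config.ring i))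
          = μ.bind fun y => (firstRing c hpos hsum).map fun i => y.ring i :=
        PMF.bind_comm (firstRing c hpos hsum) μ fun i y => PMF.pure (y.ring i)
      rw [h2]
      exact (PMF.bind_bind _ (tasepAfter c hpos hsum)
        fun y => (firstRing c hpos hsum).map fun i => y.ring i).symm
    rw [h1, PMF.bind_apply, ← ENNReal.tsum_mul_left]
    refine tsum_congr fun i => ?_
    have h3 : (r : ℝ≥0∞) * (r : ℝ≥0∞)⁻¹ = 1 :=
      ENNReal.mul_inv_cancel (by simpa using hr0) ENNReal.coe_ne_top
    rw [firstRing, PMF.normalize_apply, ← hre]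
    calc (c i : ℝ≥0∞) * (μ.map (Config.ring i)) x
        = (r * (r : ℝ≥0∞)⁻¹) * (c i * (μ.map (Config.ring i)) x) := by rw [h3, one_mul]
      _ = _ := by ring
  have hν' : ∑' i, (c i : ℝ) * ((μ.map (Config.ring i)) x).toReal
      = r * (Real.exp (-(t * r)) * ∑' n, (t * r) ^ n / n.factorial * a (n + 1)) := by
    have h2 := congrArg ENNReal.toReal hν
    rw [ENNReal.tsum_toReal_eq (fun i => ENNReal.mul_ne_top ENNReal.coe_ne_top
      (PMF.apply_ne_top _ _)), ENNReal.toReal_mul, toPMF_poisson_bind_toReal] at h2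
    simpa [ha, ht] using h2
  have hc : Summable fun i => (c i : ℝ) := NNReal.summable_coe.2 hsum
  have hrr : (r : ℝ) = ∑' i, (c i : ℝ) := NNReal.coe_tsum
  have hD : ∑' i, (c i : ℝ) * (((μ.map (Config.ring i)) x).toReal - (μ x).toReal)
      = -r * Real.exp (-(t * r)) * (∑' n, (t * r) ^ n / n.factorial * a n)
        + Real.exp (-(t * r)) * ((∑' n, (t * r) ^ n / n.factorial * a (n + 1)) * r) := by
    simp only [mul_sub]
    rw [Summable.tsum_sub, hν', tsum_mul_right, ← hrr, hμ, hf t ht]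
    · ring
    · exact Summable.of_nonneg_of_le
        (fun i => mul_nonneg (c i).coe_nonneg ENNReal.toReal_nonneg)
        (fun i => mul_le_of_le_one_right (c i).coe_nonneg (hle _)) hc
    · exact hc.mul_right _
  rw [hD]
  have hlin : HasDerivAt (fun s : ℝ => s * (r : ℝ)) r t := by
    simpa using (hasDerivAt_id t).mul_const (r : ℝ)
  have h3 := hlin.fun_neg.exp.mul ((hasDerivAt_egf a ha1 (t * r)).comp t hlin)
  refine (HasDerivAt.hasDerivWithinAt ?_).congr (fun s hs => hf s hs) (hf t ht)
  refine h3.congr_deriv ?_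
  simp only [Function.comp]
  ring

/-- The law at time `t` of TASEP with geometric speeds of ratio `q` (the `k`-th particle from the
right, `k = 1, 2, …`, has speed `q ^ (k - 1)`) and step initial configuration. -/
def geomTasepLaw (q : ℝ≥0) (hq0 : 0 < q) (hq1 : q < 1) (t : ℝ≥0) : PMF Config :=
  tasepLaw (fun i => q ^ i) (fun _ => pow_pos hq0 _) (NNReal.summable_geometric hq1) t

/-! ### The backwards Markov map -/

/-- The truncated geometric distribution on `{0, 1, …, A}`: the weight of `k` is
`(1 - α) * α ^ k` for `k < A` and `α ^ A` for `k = A`. -/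
def truncGeom (α : ℝ≥0) (hα : α ≤ 1) (A : ℕ) : PMF (Fin (A + 1)) :=
  PMF.ofFintype
    (fun k => (((if (k : ℕ) < A then (1 - α) * α ^ (k : ℕ) else α ^ A : ℝ≥0)) : ℝ≥0∞)) (by
      rw [Fin.sum_univ_castSucc]
      norm_cast
      have h : (1 - α) + α = 1 := tsub_add_cancel_of_le hα
      simp only [Fin.val_castSucc, Fin.is_lt, if_true, lt_irrefl, if_false]
      rw [Fin.sum_univ_eq_sum_range (fun k => (1 - α) * α ^ k)]
      induction A with
      | zero => simp
      | succ n ih =>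
        rw [Finset.sum_range_succ, add_assoc, pow_succ', ← add_mul, h, one_mul]
        exact ih)

namespace Config

/-- The configuration whose `i`-th particle is at `x.pos (i + 1) + 1 + Y i`, given
`0 ≤ Y i ≤ x.gap i`. -/
def moveLeft (x : Config) (Y : (i : ℕ) → Fin (x.gap i + 1)) : Config where
  pos i := x.pos (i + 1) + 1 + (Y i : ℕ)
  strictAnti := by
    refine strictAnti_nat_of_succ_lt fun n => ?_
    have h0 := x.gap_eq (n + 1)
    have h1 := (Y (n + 1)).is_le
    omega
  packed := by
    filter_upwards [x.gap_eventually_zero,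
      (Filter.tendsto_add_atTop_nat 1).eventually x.packed] with i h0 h1
    have h2 := (Y i).is_le
    push_cast at h1
    omega

/-- Only finitely many gaps are nonempty, so there are finitely many families `Y`. -/
instance (x : Config) : Countable ((i : ℕ) → Fin (x.gap i + 1)) := by
  obtain ⟨M, hM⟩ := Filter.eventually_atTop.1 x.gap_eventually_zero
  refine Function.Injective.countable
    (f := fun (Y : (i : ℕ) → Fin (x.gap i + 1)) (i : Fin M) => Y i) fun Y Z h => ?_
  funext i
  by_cases hi : i < M
  · exact congrFun h ⟨i, hi⟩
  · have h0 := hM i (not_lt.1 hi)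
    have h1 := (Y i).is_le
    have h2 := (Z i).is_le
    exact Fin.ext (by omega)

end Config

/-- The Markov map on configurations under which `x` is replaced by `x̂` with
`x̂ i = x (i + 1) + 1 + Y i`, where the `Y i` are independent and truncated geometric on
`{0, …, x i - x (i + 1) - 1}`; the `k`-th particle from the right has parameter `q ^ k`, that is,
particle `i = k - 1` has parameter `q ^ (i + 1)`. -/
def backMap (q : ℝ≥0) (hq1 : q < 1) (x : Config) : PMF Config :=
  ((MeasureTheory.Measure.infinitePi fun i : ℕ =>
    (truncGeom (q ^ (i + 1)) (pow_le_one₀ zero_le hq1.le) (x.gap i)).toMeasure).toPMF).map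
      x.moveLeft

end

/-! Everything is carried by operators on functions `Config → ℝ≥0∞`, where sums may be exchanged
freely. Let `R` be `ringOp` for the speeds `1, q, q ^ 2, …` and `B` the operator of `backMap`.

If particle `n + 1` is slower than particle `n` by a factor `α`, redrawing particle `n` with
parameter `α` intertwines the dynamics with the one where the two speeds are exchanged
(`ringOp_mul_swapMap`). Exchanging at `0, 1, 2, …` with parameters `q, q ^ 2, q ^ 3, …` carries the
speed `1` off to infinity and leaves `q, q ^ 2, …`, which is the original system slowed down by `q`;
this chain of exchanges is `backMap` (`backMap_eq_swapChain`). The particle that takes over speed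
`1` is eventually blocked, so `R B = B (1 + q R)` (`ringOp_mul_backMap`).

With `G = (1 - q) R` for one ring, this reads `G B = B (q G + (1 - q))`. Since `B` fixes the step
configuration, applying `B` after `n` rings amounts to keeping each ring with probability `q`
(`pow_geomStep_backMap`). Thinning the Poisson number of rings multiplies its mean by `q`, hence
time `q * t`. -/

namespace Config

/-! ### Moving a single particle within its gap. -/

theorem gap_spec (x : Config) (i : ℕ) : x.pos i = x.pos (i + 1) + 1 + x.gap i := by
  have := x.gap_eq i
  omega

theorem exists_pos_eq_iff (x : Config) (i : ℕ) :
    (∃ j, x.pos j = x.pos i + 1) ↔ ∃ j, i = j + 1 ∧ x.pos j = x.pos i + 1 := by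
  refine ⟨fun ⟨j, hj⟩ => ⟨j, ?_, hj⟩, fun ⟨j, _, hj⟩ => ⟨j, hj⟩⟩
  have h1 : j < i := x.strictAnti.lt_iff_gt.1 (by omega)
  by_contra h2
  have h3 := x.strictAnti (show j < j + 1 by omega)
  have h4 := x.strictAnti (show j + 1 < i by omega)
  omega

theorem ring_of_occupied {x : Config} {i : ℕ} (h : ∃ j, x.pos j = x.pos i + 1) :
    x.ring i = x := by
  rw [ring, dif_pos h]

theorem ring_pos_of_free {x : Config} {i : ℕ} (h : ¬ ∃ j, x.pos j = x.pos i + 1) :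
    (x.ring i).pos = Function.update x.pos i (x.pos i + 1) := by
  rw [ring, dif_neg h]

open Classical in
/-- Move particle `n` to the site `p` if this respects the order of the particles. -/
noncomputable def setPos (x : Config) (n : ℕ) (p : ℤ) : Config :=
  if h : StrictAnti (Function.update x.pos n p) then
    { pos := Function.update x.pos n p
      strictAnti := h
      packed := by
        filter_upwards [x.packed, Filter.eventually_gt_atTop n] with j hj hij
        rw [Function.update_of_ne (by omega), hj] }
  else x

theorem setPos_pos {x : Config} {n : ℕ} {p : ℤ} (hlo : x.pos (n + 1) < p)
    (hhi : ∀ m, n = m + 1 → p < x.pos m) :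
    (x.setPos n p).pos = Function.update x.pos n p := by
  rw [setPos, dif_pos]
  refine strictAnti_nat_of_succ_lt fun j => ?_
  have h0 := x.strictAnti (Nat.lt_succ_self j)
  simp only [Nat.succ_eq_add_one] at h0
  by_cases a : j = n
  · subst a; simpa
  · by_cases b : j + 1 = n
    · subst b; simpa using hhi j rfl
    · simp [a, b, h0]

/-- Move particle `n` to distance `k + 1` from its left neighbour. -/
noncomputable def place (x : Config) (n k : ℕ) : Config :=
  x.setPos n (x.pos (n + 1) + 1 + k)

theorem place_pos {x : Config} {n k : ℕ} (hk : k ≤ x.gap n) :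
    (x.place n k).pos = Function.update x.pos n (x.pos (n + 1) + 1 + k) := by
  refine setPos_pos (by omega) fun m hm => ?_
  have h1 := x.gap_spec n
  have h2 := x.strictAnti (show m < n by omega)
  omega

/-- The extra value `k = x.gap n + 1` is the site just right of particle `n`; it is what lets a jump
of particle `n` be written as a `place`. -/
theorem place_pos_of_free {x : Config} {n k : ℕ} (h : ¬ ∃ j, x.pos j = x.pos n + 1)
    (hk : k ≤ x.gap n + 1) :
    (x.place n k).pos = Function.update x.pos n (x.pos (n + 1) + 1 + k) := by
  refine setPos_pos (by omega) fun m hm => ?_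
  have h1 := x.gap_spec n
  have h2 := x.strictAnti (show m < n by omega)
  have h3 : x.pos m ≠ x.pos n + 1 := fun h4 => h ⟨m, h4⟩
  omega

theorem place_gap (x : Config) (n : ℕ) : x.place n (x.gap n) = x := by
  ext i
  rw [place_pos le_rfl, ← gap_spec, Function.update_eq_self]

/-! ### How clock rings interact with `place`. -/

section Commutation

variable {x : Config} {n : ℕ}

theorem gap_ring_of_ne {i : ℕ} (h1 : i ≠ n) (h2 : i ≠ n + 1) : (x.ring i).gap n = x.gap n := by
  by_cases h : ∃ j, x.pos j = x.pos i + 1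
  · rw [ring_of_occupied h]
  · rw [gap, ring_pos_of_free h, Function.update_of_ne h1.symm, Function.update_of_ne h2.symm, gap]

/-- Whether particle `i` is blocked depends only on particles `i` and `i - 1`, and neither of them
is particle `n`. -/
theorem ring_place_of_ne {i k : ℕ} (h1 : i ≠ n) (h2 : i ≠ n + 1) (hk : k ≤ x.gap n) :
    (x.place n k).ring i = (x.ring i).place n k := by
  have hiff : (∃ j, (x.place n k).pos j = (x.place n k).pos i + 1) ↔
      ∃ j, x.pos j = x.pos i + 1 := by
    rw [exists_pos_eq_iff, exists_pos_eq_iff, place_pos hk]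
    refine exists_congr fun j => and_congr_right fun hj => ?_
    rw [Function.update_of_ne h1, Function.update_of_ne (by omega)]
  by_cases h : ∃ j, x.pos j = x.pos i + 1
  · rw [ring_of_occupied h, ring_of_occupied (hiff.2 h)]
  · apply Config.ext
    rw [ring_pos_of_free (hiff.not.2 h), place_pos (hk.trans (gap_ring_of_ne h1 h2).ge),
      ring_pos_of_free h, place_pos hk, Function.update_of_ne h1,
      Function.update_of_ne h2.symm, Function.update_comm h1]

theorem gap_ring_self (h : ¬ ∃ j, x.pos j = x.pos n + 1) : (x.ring n).gap n = x.gap n + 1 := by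
  have h1 := (x.ring n).gap_eq n
  have h2 := x.gap_eq n
  rw [ring_pos_of_free h, Function.update_self, Function.update_of_ne (by omega)] at h1
  omega

theorem place_ring_self {k : ℕ} (h : ¬ ∃ j, x.pos j = x.pos n + 1) (hk : k ≤ x.gap n + 1) :
    (x.ring n).place n k = x.place n k := by
  apply Config.ext
  rw [place_pos (hk.trans (gap_ring_self h).ge), place_pos_of_free h hk, ring_pos_of_free h,
    Function.update_of_ne (show n + 1 ≠ n by omega), Function.update_idem]

theorem place_free {k : ℕ} (hk : k ≤ x.gap n)
    (h : (¬ ∃ j, x.pos j = x.pos n + 1) ∨ k < x.gap n) :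
    ¬ ∃ j, (x.place n k).pos j = (x.place n k).pos n + 1 := by
  rw [exists_pos_eq_iff, place_pos hk]
  rintro ⟨j, hj, hj'⟩
  rw [Function.update_self, Function.update_of_ne (by omega)] at hj'
  have h1 := x.gap_spec n
  have h2 := x.strictAnti (show j < n by omega)
  rcases h with h | h
  · exact h ⟨j, by omega⟩
  · omega

theorem ring_place_self {k : ℕ} (hk : k ≤ x.gap n)
    (h : (¬ ∃ j, x.pos j = x.pos n + 1) ∨ k < x.gap n) :
    (x.place n k).ring n = x.place n (k + 1) := by
  apply Config.ext
  have h1 : (x.place n (k + 1)).pos = Function.update x.pos n (x.pos (n + 1) + 1 + (k + 1 : ℕ)) :=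
    h.elim (fun h => place_pos_of_free h (by omega)) fun h => place_pos h
  rw [ring_pos_of_free (place_free hk h), h1, place_pos hk, Function.update_self,
    Function.update_idem]
  push_cast
  ring_nf

theorem ring_succ_of_gap_eq_zero (h : x.gap n = 0) : x.ring (n + 1) = x :=
  ring_of_occupied ⟨n, by have := x.gap_spec n; omega⟩

theorem free_succ (h : x.gap n ≠ 0) : ¬ ∃ j, x.pos j = x.pos (n + 1) + 1 := by
  rw [exists_pos_eq_iff]
  rintro ⟨j, hj, hj'⟩
  obtain rfl : j = n := by omega
  have := x.gap_spec j
  omega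

theorem gap_ring_succ (h : x.gap n ≠ 0) : (x.ring (n + 1)).gap n = x.gap n - 1 := by
  have h1 := (x.ring (n + 1)).gap_eq n
  have h2 := x.gap_eq n
  rw [ring_pos_of_free (free_succ h), Function.update_self, Function.update_of_ne (by omega)] at h1
  omega

theorem gap_place {k : ℕ} (hk : k ≤ x.gap n) : (x.place n k).gap n = k := by
  have h1 := (x.place n k).gap_eq n
  rw [place_pos hk, Function.update_self, Function.update_of_ne (by omega)] at h1
  omega

theorem ring_succ_place_succ {k : ℕ} (hk : k + 1 ≤ x.gap n) :
    (x.place n (k + 1)).ring (n + 1) = (x.ring (n + 1)).place n k := by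
  apply Config.ext
  have h0 : x.gap n ≠ 0 := by omega
  rw [ring_pos_of_free (free_succ (by rw [gap_place hk]; omega)),
    place_pos hk, place_pos (by rw [gap_ring_succ h0]; omega), ring_pos_of_free (free_succ h0),
    Function.update_of_ne (show n + 1 ≠ n by omega), Function.update_self,
    Function.update_comm (show n + 1 ≠ n by omega)]
  push_cast
  ring_nf

theorem ring_succ_place_zero : (x.place n 0).ring (n + 1) = x.place n 0 :=
  ring_succ_of_gap_eq_zero (gap_place (Nat.zero_le _))

end Commutation

end Config

/-! ### Truncated geometric averages -/

/-- The mean of `F` under the truncated geometric distribution. -/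
noncomputable def geomMean (α : ℝ≥0) (hα : α ≤ 1) (A : ℕ) (F : ℕ → ℝ≥0∞) : ℝ≥0∞ :=
  ∑ k : Fin (A + 1), truncGeom α hα A k * F k

section geomMean

variable {α : ℝ≥0} (hα : α ≤ 1)

theorem geomMean_congr {A : ℕ} {F G : ℕ → ℝ≥0∞} (h : ∀ k ≤ A, F k = G k) :
    geomMean α hα A F = geomMean α hα A G :=
  Finset.sum_congr rfl fun k _ => by rw [h k k.is_le]

theorem geomMean_zero (F : ℕ → ℝ≥0∞) : geomMean α hα 0 F = F 0 := by
  simp [geomMean, truncGeom]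

/-- Lack of memory: a truncated geometric variable stops at `0` with probability `1 - α`, and
otherwise starts afresh from `1`. -/
theorem geomMean_succ (A : ℕ) (F : ℕ → ℝ≥0∞) : geomMean α hα (A + 1) F =
    ((1 - α : ℝ≥0) : ℝ≥0∞) * F 0 + α * geomMean α hα A fun k => F (k + 1) := by
  rw [geomMean, Fin.sum_univ_succ, geomMean, Finset.mul_sum]
  congr 1
  · simp [truncGeom]
  · refine Finset.sum_congr rfl fun k _ => ?_
    simp only [truncGeom, PMF.ofFintype_apply, Fin.val_succ, add_lt_add_iff_right]
    split_ifs
    · push_cast; ring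
    · push_cast; ring

/-- The variable is `min` of a geometric one and the truncation level, so the level is invisible to
a function that does not separate its last two values. -/
theorem geomMean_succ_of_eq {A : ℕ} {F : ℕ → ℝ≥0∞} (h : F (A + 1) = F A) :
    geomMean α hα (A + 1) F = geomMean α hα A F := by
  induction A generalizing F with
  | zero =>
    rw [geomMean_succ, geomMean_zero, geomMean_zero, zero_add, h, ← add_mul, ← ENNReal.coe_add,
      tsub_add_cancel_of_le hα, ENNReal.coe_one, one_mul]
  | succ A ih => rw [geomMean_succ, ih h, geomMean_succ]

end geomMean

/-! ### Kernels as operators on functions -/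

theorem PMF.tsum_bind_mul {α β : Type*} (p : PMF α) (κ : α → PMF β) (f : β → ℝ≥0∞) :
    ∑' b, (p.bind κ) b * f b = ∑' a, p a * ∑' b, κ a b * f b := by
  simp_rw [PMF.bind_apply, ← ENNReal.tsum_mul_right, ← ENNReal.tsum_mul_left]
  rw [ENNReal.tsum_comm]
  simp_rw [mul_assoc]

theorem PMF.tsum_pure_mul {β : Type*} (b : β) (f : β → ℝ≥0∞) :
    ∑' y, (PMF.pure b) y * f y = f b := by
  rw [tsum_eq_single b fun y hy => by simp [PMF.pure_apply, hy]]
  simp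

theorem PMF.tsum_map_mul {α β : Type*} (p : PMF α) (g : α → β) (f : β → ℝ≥0∞) :
    ∑' b, (p.map g) b * f b = ∑' a, p a * f (g a) := by
  rw [PMF.map, PMF.tsum_bind_mul]
  simp

/-- The operator `f ↦ (x ↦ 𝔼 f)` of a Markov kernel, where the mean is over the image of `x`. -/
noncomputable def kernelOp (κ : Config → PMF Config) : Module.End ℝ≥0∞ (Config → ℝ≥0∞) where
  toFun f x := ∑' y, κ x y * f y
  map_add' f g := by
    ext x
    simp [mul_add, ENNReal.tsum_add]
  map_smul' r f := by
    ext x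
    simp [← ENNReal.tsum_mul_left, mul_left_comm]

theorem kernelOp_apply (κ : Config → PMF Config) (f : Config → ℝ≥0∞) (x : Config) :
    kernelOp κ f x = ∑' y, κ x y * f y := rfl

/-- The kernel applied earlier in time is the left factor. -/
theorem kernelOp_bind (κ η : Config → PMF Config) :
    kernelOp (fun x => (κ x).bind η) = kernelOp κ * kernelOp η := by
  ext f x
  exact PMF.tsum_bind_mul _ _ _

theorem kernelOp_pure : kernelOp PMF.pure = 1 := by
  ext f x
  exact PMF.tsum_pure_mul _ _

open Classical in
theorem kernelOp_single (κ : Config → PMF Config) (x y : Config) :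
    kernelOp κ (Pi.single y 1) x = κ x y := by
  rw [kernelOp_apply, tsum_eq_single y fun z hz => by simp [hz]]
  simp

theorem kernelOp_congr {κ : Config → PMF Config} {f g : Config → ℝ≥0∞} {x : Config}
    (h : ∀ y, κ x y ≠ 0 → f y = g y) : kernelOp κ f x = kernelOp κ g x := by
  refine tsum_congr fun y => ?_
  by_cases hy : κ x y = 0
  · simp [hy]
  · rw [h y hy]

/-- The sum over all particles of `c i` times the value of a function after a ring of the clock of
particle `i`. -/
noncomputable def ringOp (c : ℕ → ℝ≥0) : Module.End ℝ≥0∞ (Config → ℝ≥0∞) where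
  toFun f x := ∑' i, (c i : ℝ≥0∞) * f (x.ring i)
  map_add' f g := by
    ext x
    simp [mul_add, ENNReal.tsum_add]
  map_smul' r f := by
    ext x
    simp [← ENNReal.tsum_mul_left, mul_left_comm]

theorem ringOp_apply (c : ℕ → ℝ≥0) (f : Config → ℝ≥0∞) (x : Config) :
    ringOp c f x = ∑' i, (c i : ℝ≥0∞) * f (x.ring i) := rfl

/-! ### Exchanging two neighbouring speeds -/

/-- The Markov map moving particle `n` to a truncated geometric distance from particle `n + 1`. -/
noncomputable def swapMap (α : ℝ≥0) (hα : α ≤ 1) (n : ℕ) (x : Config) : PMF Config :=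
  (truncGeom α hα (x.gap n)).map fun k : Fin (x.gap n + 1) => x.place n (k : ℕ)

theorem kernelOp_swapMap (α : ℝ≥0) (hα : α ≤ 1) (n : ℕ) (f : Config → ℝ≥0∞) (x : Config) :
    kernelOp (swapMap α hα n) f x = geomMean α hα (x.gap n) fun k => f (x.place n k) := by
  rw [kernelOp_apply, swapMap, PMF.tsum_map_mul, tsum_fintype, geomMean]

theorem ENNReal.tsum_eq_tsum_of_pair {g h : ℕ → ℝ≥0∞} (n : ℕ)
    (hne : ∀ i, i ≠ n → i ≠ n + 1 → g i = h i)
    (hpair : g n + g (n + 1) = h n + h (n + 1)) : ∑' i, g i = ∑' i, h i := by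
  rw [← Summable.sum_add_tsum_nat_add' (f := g) (k := n + 2) ENNReal.summable,
    ← Summable.sum_add_tsum_nat_add' (f := h) (k := n + 2) ENNReal.summable,
    Finset.sum_range_succ, Finset.sum_range_succ, Finset.sum_range_succ _ (n + 1),
    Finset.sum_range_succ, add_assoc _ (g n) (g (n + 1)), hpair, ← add_assoc _ (h n)]
  congr 1
  · congr 2
    refine Finset.sum_congr rfl fun i hi => ?_
    rw [Finset.mem_range] at hi
    exact hne i (by omega) (by omega)
  · exact tsum_congr fun i => hne _ (by omega) (by omega)

/-- The only nontrivial part of the intertwining: the rings of particles `n` and `n + 1` match only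
in sum, through the common term `f (x.place n 0)`. -/
theorem ringOp_swapMap_pair {a α : ℝ≥0} (hα : α ≤ 1) (n : ℕ) (f : Config → ℝ≥0∞) (x : Config) :
    (a : ℝ≥0∞) * kernelOp (swapMap α hα n) f (x.ring n)
        + (a * α : ℝ≥0∞) * kernelOp (swapMap α hα n) f (x.ring (n + 1))
      = (a * α : ℝ≥0∞) * geomMean α hα (x.gap n) (fun k => f ((x.place n k).ring n))
        + a * geomMean α hα (x.gap n) (fun k => f ((x.place n k).ring (n + 1))) := by
  -- If particle `n` can jump, its gap grows by one and `geomMean_succ` applies. If it is blocked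
  -- but has a gap, the two topmost placements have the same image under `ring n`, so
  -- `geomMean_succ_of_eq` absorbs the difference. The excluded case is a blocked particle without
  -- gap.
  have hself : kernelOp (swapMap α hα n) f (x.ring n) =
      ((1 - α : ℝ≥0) : ℝ≥0∞) * f (x.place n 0)
        + α * geomMean α hα (x.gap n) (fun k => f ((x.place n k).ring n)) ∨
      (x.gap n = 0 ∧ x.ring n = x) := by
    by_cases h : ∃ j, x.pos j = x.pos n + 1
    · rw [or_iff_not_imp_right, Config.ring_of_occupied h]
      intro hA
      obtain ⟨B, hB⟩ : ∃ B, x.gap n = B + 1 := Nat.exists_eq_succ_of_ne_zero (by tauto)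
      rw [kernelOp_swapMap, hB, geomMean_succ, geomMean_succ_of_eq (A := B)]
      · congr 2
        refine geomMean_congr hα fun k hk => ?_
        rw [Config.ring_place_self (by omega) (Or.inr (by omega))]
      · rw [Config.ring_place_self (k := B) (by omega) (Or.inr (by omega)), ← hB, Config.place_gap,
          Config.ring_of_occupied h]
    · left
      rw [kernelOp_swapMap, Config.gap_ring_self h, geomMean_succ,
        Config.place_ring_self h (by omega)]
      congr 2
      refine geomMean_congr hα fun k hk => ?_
      rw [Config.place_ring_self h (by omega), Config.ring_place_self hk (Or.inl h)]
  have h1 : ((1 - α : ℝ≥0) : ℝ≥0∞) + α = 1 := by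
    rw [← ENNReal.coe_add, tsub_add_cancel_of_le hα, ENNReal.coe_one]
  rcases Nat.eq_zero_or_pos (x.gap n) with h0 | h0
  · have hx : x.place n 0 = x := by rw [← h0, Config.place_gap]
    rw [Config.ring_succ_of_gap_eq_zero h0]
    rcases hself with hs | ⟨-, hs⟩
    · rw [hs, kernelOp_swapMap, h0]
      simp only [geomMean_zero, hx, Config.ring_succ_of_gap_eq_zero h0]
      calc _ = (a * α : ℝ≥0∞) * f (x.ring n) + a * ((((1 - α : ℝ≥0) : ℝ≥0∞) + α) * f x) := by ring
        _ = _ := by rw [h1, one_mul]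
    · rw [hs, kernelOp_swapMap, h0]
      simp only [geomMean_zero, hx, hs, Config.ring_succ_of_gap_eq_zero h0]
      ring
  · obtain ⟨B, hB⟩ : ∃ B, x.gap n = B + 1 := Nat.exists_eq_succ_of_ne_zero h0.ne'
    have hs := hself.resolve_right (by omega)
    -- At `k = 0` particle `n + 1` is blocked, which produces the weight `1 - α` on `x.place n 0`;
    -- for the other `k` its jump shortens the gap by one.
    rw [hs, kernelOp_swapMap, Config.gap_ring_succ h0.ne', hB, Nat.add_sub_cancel,
      geomMean_succ hα B (fun k => f ((x.place n k).ring (n + 1))), Config.ring_succ_place_zero,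
      geomMean_congr hα (A := B) (F := fun k => f ((x.place n (k + 1)).ring (n + 1)))
        (G := fun k => f ((x.ring (n + 1)).place n k))
        fun k hk => by rw [Config.ring_succ_place_succ (by omega)]]
    ring

theorem ringOp_mul_swapMap {c c' : ℕ → ℝ≥0} {α : ℝ≥0} (hα : α ≤ 1) {n : ℕ}
    (h0 : c (n + 1) = c n * α) (h1 : c' n = c (n + 1)) (h2 : c' (n + 1) = c n)
    (h3 : ∀ i, i ≠ n → i ≠ n + 1 → c' i = c i) :
    ringOp c * kernelOp (swapMap α hα n) = kernelOp (swapMap α hα n) * ringOp c' := by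
  ext f x
  simp only [Module.End.mul_apply]
  rw [kernelOp_swapMap, geomMean]
  simp only [ringOp_apply, ← ENNReal.tsum_mul_left]
  rw [← Summable.tsum_finsetSum fun _ _ => ENNReal.summable]
  have key : ∀ i, ∑ k : Fin (x.gap n + 1), truncGeom α hα (x.gap n) k *
      ((c' i : ℝ≥0∞) * f ((x.place n k).ring i)) =
      c' i * geomMean α hα (x.gap n) fun k => f ((x.place n k).ring i) := fun i => by
    rw [geomMean, Finset.mul_sum]
    exact Finset.sum_congr rfl fun k _ => by ring
  simp only [key]
  refine ENNReal.tsum_eq_tsum_of_pair n (fun i hi hi' => ?_) ?_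
  · rw [h3 i hi hi', kernelOp_swapMap, Config.gap_ring_of_ne hi hi']
    congr 1
    exact geomMean_congr hα fun k hk => by rw [Config.ring_place_of_ne hi hi' hk]
  · rw [h2, h1, h0, ENNReal.coe_mul]
    exact ringOp_swapMap_pair hα n f x

/-! ### The backwards map as a chain of exchanges -/

section Chain

variable (q : ℝ≥0) (hq1 : q < 1)

/-- The speeds obtained from the geometric speeds `1, q, q ^ 2, …` by moving the first one to
place `m`. -/
def shiftedSpeeds (m i : ℕ) : ℝ≥0 := if i < m then q ^ (i + 1) else if i = m then 1 else q ^ i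

/-- The composition of the exchange maps at `m, m + 1, …, m + l - 1`. -/
noncomputable def swapChain : ℕ → ℕ → Config → PMF Config
  | _, 0 => PMF.pure
  | m, l + 1 => fun x =>
      (swapMap (q ^ (m + 1)) (pow_le_one₀ zero_le hq1.le) m x).bind (swapChain (m + 1) l)

/-- At place `m` the speeds are `1` and then `q ^ (m + 1)`, so their ratio is exactly the parameter
of the exchange there. -/
theorem ringOp_mul_swapChain (m l : ℕ) :
    ringOp (shiftedSpeeds q m) * kernelOp (swapChain q hq1 m l) =
      kernelOp (swapChain q hq1 m l) * ringOp (shiftedSpeeds q (m + l)) := by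
  induction l generalizing m with
  | zero => simp [swapChain, kernelOp_pure]
  | succ l ih =>
    rw [swapChain, kernelOp_bind, ← mul_assoc, ringOp_mul_swapMap (c' := shiftedSpeeds q (m + 1)),
      mul_assoc, ih, ← mul_assoc, show m + 1 + l = m + (l + 1) by omega]
    · simp [shiftedSpeeds]
    · simp [shiftedSpeeds]
    · simp [shiftedSpeeds]
    · intro i h1 h2
      simp only [shiftedSpeeds, h1, h2, if_false, show i < m + 1 ↔ i < m by omega]

/-- The probability that the backwards map moves particle `i` of `x` to its place in `y`. -/
noncomputable def moveProb (i : ℕ) (x y : Config) : ℝ≥0∞ :=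
  geomMean (q ^ (i + 1)) (pow_le_one₀ zero_le hq1.le) (x.gap i)
    fun k => if y.pos i = x.pos (i + 1) + 1 + k then 1 else 0

open Classical in
theorem swapChain_apply (m l : ℕ) (x y : Config) : swapChain q hq1 m l x y =
    if ∀ j, j < m ∨ m + l ≤ j → y.pos j = x.pos j then
      ∏ i ∈ Finset.range l, moveProb q hq1 (m + i) x y else 0 := by
  induction l generalizing m x with
  | zero =>
    rw [swapChain, PMF.pure_apply, Finset.prod_range_zero]
    congr 1
    refine propext ⟨fun h j _ => by rw [h], fun h => ?_⟩
    ext j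
    exact h j (by omega)
  | succ l ih =>
    rw [swapChain, PMF.bind_apply, swapMap, PMF.tsum_map_mul, tsum_fintype]
    have hterm : ∀ k : Fin (x.gap m + 1), swapChain q hq1 (m + 1) l (x.place m k) y =
        (if y.pos m = x.pos (m + 1) + 1 + (k : ℕ) then 1 else 0) *
          if ∀ j, j < m ∨ m + (l + 1) ≤ j → y.pos j = x.pos j then
            ∏ i ∈ Finset.range l, moveProb q hq1 (m + 1 + i) x y else 0 := fun k => by
      -- Later factors read only positions of particles from `m + 1` on, which moving particle `m`
      -- leaves alone; hence the sequential moves give a product, as the independent ones do.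
      have hw : ∀ i, moveProb q hq1 (m + 1 + i) (x.place m k) y =
          moveProb q hq1 (m + 1 + i) x y := fun i => by
        have h1 : (x.place m k).gap (m + 1 + i) = x.gap (m + 1 + i) := by
          rw [Config.gap, Config.place_pos k.is_le, Function.update_of_ne (by omega),
            Function.update_of_ne (by omega), Config.gap]
        rw [moveProb, moveProb, h1, Config.place_pos k.is_le, Function.update_of_ne (by omega)]
      simp only [ih, hw]
      rw [Config.place_pos k.is_le, ite_mul, one_mul, zero_mul, ← ite_and]
      congr 1
      refine propext ⟨fun h => ⟨?_, fun j hj => ?_⟩, fun h j hj => ?_⟩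
      · simpa using h m (by omega)
      · simpa [show j ≠ m by omega] using h j (by omega)
      · by_cases hjm : j = m
        · subst hjm
          simpa using h.1
        · simpa [hjm] using h.2 j (by omega)
    simp_rw [hterm, ← mul_assoc]
    rw [← Finset.sum_mul, Finset.prod_range_succ', mul_comm, ite_mul, zero_mul]
    simp_rw [add_zero, ← add_assoc, add_right_comm m 1]
    rfl

theorem measure_toPMF_map_apply {α β : Type*} [MeasurableSpace α] [Countable α]
    [MeasurableSingletonClass α] (μ : MeasureTheory.Measure α)
    [MeasureTheory.IsProbabilityMeasure μ] (f : α → β) (b : β) :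
    (μ.toPMF.map f) b = μ {a | b = f a} := by
  classical
  rw [PMF.map_apply]
  conv_rhs => rw [← MeasureTheory.Measure.toPMF_toMeasure μ]
  rw [PMF.toMeasure_apply _ (Set.to_countable _).measurableSet]
  exact tsum_congr fun a => by simp [Set.indicator_apply]

open Classical in
theorem backMap_apply {x : Config} {N : ℕ} (hx : ∀ i, N ≤ i → x.pos i = -((i : ℤ) + 1))
    (y : Config) : backMap q hq1 x y =
      if ∀ j, N ≤ j → y.pos j = x.pos j then
        ∏ i ∈ Finset.range N, moveProb q hq1 i x y else 0 := by
  have hgap : ∀ i, N ≤ i → x.gap i = 0 := fun i hi => by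
    have h1 := x.gap_eq i
    rw [hx i hi, hx (i + 1) (by omega)] at h1
    push_cast at h1
    omega
  have htail : ∀ (Y : (i : ℕ) → Fin (x.gap i + 1)) (i : ℕ), N ≤ i →
      (x.moveLeft Y).pos i = x.pos i := fun Y i hi => by
    have h1 := (Y i).is_le
    have h2 := x.gap_spec i
    have h3 := hgap i hi
    simp only [Config.moveLeft]
    omega
  rw [backMap, measure_toPMF_map_apply]
  split_ifs with h
  · have hset : {Y : (i : ℕ) → Fin (x.gap i + 1) | y = x.moveLeft Y} =
        Set.pi (Finset.range N) fun i => {k : Fin (x.gap i + 1) | y.pos i = x.pos (i + 1) + 1 + (k : ℕ)} := by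
      ext Y
      simp only [Set.mem_ofPred_eq, Set.mem_pi, Finset.coe_range, Set.mem_Iio]
      refine ⟨fun hY i _ => by rw [hY]; rfl, fun hY => ?_⟩
      ext i
      by_cases hi : i < N
      · exact hY i hi
      · rw [h i (by omega), htail Y i (by omega)]
    rw [hset, MeasureTheory.Measure.infinitePi_pi _ fun i _ => (Set.to_countable _).measurableSet]
    refine Finset.prod_congr rfl fun i _ => ?_
    rw [PMF.toMeasure_apply_fintype, moveProb, geomMean]
    exact Finset.sum_congr rfl fun k _ => by simp [Set.indicator_apply]
  · rw [show {Y : (i : ℕ) → Fin (x.gap i + 1) | y = x.moveLeft Y} = ∅ from ?_,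
      MeasureTheory.measure_empty]
    refine Set.eq_empty_of_forall_notMem fun Y hY => h fun j hj => ?_
    rw [show y = x.moveLeft Y from hY, htail Y j hj]

theorem backMap_eq_swapChain {x : Config} {N : ℕ}
    (hx : ∀ i, N ≤ i → x.pos i = -((i : ℤ) + 1)) : backMap q hq1 x = swapChain q hq1 0 N x := by
  classical
  ext y
  rw [backMap_apply q hq1 hx, swapChain_apply]
  simp only [zero_add]
  exact if_congr (by simp) rfl rfl

end Chain

/-! ### Intertwining of the dynamics with the backwards map -/

theorem Config.ring_of_packed {x : Config} {N i : ℕ} (hx : ∀ j, N ≤ j → x.pos j = -((j : ℤ) + 1))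
    (hi : N < i) : x.ring i = x := by
  refine Config.ring_of_occupied ⟨i - 1, ?_⟩
  rw [hx _ (by omega), hx _ hi.le]
  omega

theorem Config.ring_packed {x : Config} {N : ℕ} (hx : ∀ j, N ≤ j → x.pos j = -((j : ℤ) + 1))
    (i j : ℕ) (hj : N + 1 ≤ j) : (x.ring i).pos j = -((j : ℤ) + 1) := by
  rcases lt_or_ge N i with hi | hi
  · rw [Config.ring_of_packed hx hi, hx j (by omega)]
  · by_cases h : ∃ j, x.pos j = x.pos i + 1
    · rw [Config.ring_of_occupied h, hx j (by omega)]
    · rw [Config.ring_pos_of_free h, Function.update_of_ne (by omega), hx j (by omega)]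

theorem shiftedSpeeds_zero (q : ℝ≥0) : shiftedSpeeds q 0 = fun i => q ^ i := by
  ext i
  rcases i with _ | i <;> simp [shiftedSpeeds]

/-- Particle `N + 1` has speed `1` but is blocked, which gives `f x`. Beyond it all rings are
trivial too, so those speeds may be shifted by one index to match `q * q ^ i`. -/
theorem ringOp_shiftedSpeeds (q : ℝ≥0) {x : Config} {N : ℕ}
    (hx : ∀ j, N ≤ j → x.pos j = -((j : ℤ) + 1)) (f : Config → ℝ≥0∞) :
    ringOp (shiftedSpeeds q (N + 1)) f x = f x + q * ringOp (fun i => q ^ i) f x := by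
  simp only [ringOp_apply]
  rw [← Summable.sum_add_tsum_nat_add' (k := N + 1) ENNReal.summable,
    ← Summable.sum_add_tsum_nat_add' (f := fun i => ((q ^ i : ℝ≥0) : ℝ≥0∞) * f (x.ring i))
      (k := N + 1) ENNReal.summable, mul_add, Finset.mul_sum, ← ENNReal.tsum_mul_left,
    tsum_eq_zero_add' (f := fun i => (shiftedSpeeds q (N + 1) (i + (N + 1)) : ℝ≥0∞) *
      f (x.ring (i + (N + 1)))) ENNReal.summable, add_left_comm]
  congr 1
  · rw [Config.ring_of_packed hx (by omega)]
    simp [shiftedSpeeds]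
  · congr 1
    · refine Finset.sum_congr rfl fun i hi => ?_
      rw [shiftedSpeeds, if_pos (Finset.mem_range.1 hi), pow_succ']
      push_cast
      ring
    · refine tsum_congr fun i => ?_
      rw [Config.ring_of_packed hx (by omega), Config.ring_of_packed hx (by omega),
        shiftedSpeeds, if_neg (by omega), if_neg (by omega)]
      push_cast
      ring

theorem ringOp_mul_backMap (q : ℝ≥0) (hq1 : q < 1) :
    ringOp (fun i => q ^ i) * kernelOp (backMap q hq1) =
      kernelOp (backMap q hq1) * (1 + (q : ℝ≥0∞) • ringOp fun i => q ^ i) := by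
  ext f x
  obtain ⟨N, hx⟩ := Filter.eventually_atTop.1 x.packed
  -- A ring may free particle `N` from its packed position, so a chain of length `N + 1` serves both
  -- `x` and every `x.ring i`.
  have hx' : ∀ j, N + 1 ≤ j → x.pos j = -((j : ℤ) + 1) := fun j hj => hx j (by omega)
  have hchain := congrFun (LinearMap.congr_fun (ringOp_mul_swapChain q hq1 0 (N + 1)) f) x
  rw [zero_add, shiftedSpeeds_zero] at hchain
  simp only [Module.End.mul_apply] at hchain ⊢
  have h1 : ringOp (fun i => q ^ i) (kernelOp (backMap q hq1) f) x =
      ringOp (fun i => q ^ i) (kernelOp (swapChain q hq1 0 (N + 1)) f) x := by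
    simp only [ringOp_apply, kernelOp_apply]
    refine tsum_congr fun i => ?_
    rw [backMap_eq_swapChain q hq1 (Config.ring_packed hx i)]
  rw [h1, hchain, kernelOp_apply, ← backMap_eq_swapChain q hq1 hx', ← kernelOp_apply]
  refine kernelOp_congr fun y hy => ?_
  -- The image under `backMap` stays packed from `N`, so its particle `N + 1`, which now carries
  -- speed `1`, is blocked.
  have hy' : ∀ j, N ≤ j → y.pos j = -((j : ℤ) + 1) := by
    classical
    rw [backMap_apply q hq1 hx] at hy
    have h2 := (ite_ne_right_iff.1 hy).1
    exact fun j hj => by rw [h2 j hj, hx j hj]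
  rw [ringOp_shiftedSpeeds q hy']
  rfl

/-- One ring of a clock, for speeds `1, q, q ^ 2, …`. -/
noncomputable def geomStep (q : ℝ≥0) (hq0 : 0 < q) (hq1 : q < 1) (x : Config) : PMF Config :=
  (firstRing (fun i => q ^ i) (fun _ => pow_pos hq0 _) (NNReal.summable_geometric hq1)).map
    fun i => x.ring i

/-! ### The binomial formula for the number of effective rings. -/

section GeomStep

variable (q : ℝ≥0) (hq0 : 0 < q) (hq1 : q < 1)

theorem kernelOp_geomStep :
    kernelOp (geomStep q hq0 hq1) = (1 - q : ℝ≥0∞) • ringOp fun i => q ^ i := by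
  ext f x
  rw [kernelOp_apply, geomStep, PMF.tsum_map_mul, LinearMap.smul_apply, Pi.smul_apply,
    ringOp_apply, smul_eq_mul, ← ENNReal.tsum_mul_left]
  refine tsum_congr fun i => ?_
  rw [firstRing, PMF.normalize_apply]
  simp only [ENNReal.coe_pow]
  -- The total rate is `(1 - q)⁻¹`, whence the factor `1 - q`.
  rw [ENNReal.tsum_geometric, inv_inv]
  ring

theorem semiconjBy_backMap : SemiconjBy (kernelOp (backMap q hq1))
    ((q : ℝ≥0∞) • kernelOp (geomStep q hq0 hq1) + (1 - q : ℝ≥0∞) • 1)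
    (kernelOp (geomStep q hq0 hq1)) := by
  rw [SemiconjBy, kernelOp_geomStep, smul_mul_assoc, ringOp_mul_backMap, mul_add, mul_add,
    smul_add, add_comm, mul_smul_comm, mul_smul_comm, mul_smul_comm, mul_smul_comm, smul_comm]

theorem kernelOp_backMap_step (f : Config → ℝ≥0∞) :
    kernelOp (backMap q hq1) f Config.step = f Config.step := by
  rw [kernelOp_apply, backMap_eq_swapChain q hq1 (N := 0) fun _ _ => rfl]
  exact PMF.tsum_pure_mul _ _

theorem tsum_tasepAfter_mul (n : ℕ) (f : Config → ℝ≥0∞) :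
    ∑' x, tasepAfter (fun i => q ^ i) (fun _ => pow_pos hq0 _) (NNReal.summable_geometric hq1) n x
      * f x = (kernelOp (geomStep q hq0 hq1) ^ n) f Config.step := by
  induction n generalizing f with
  | zero => exact PMF.tsum_pure_mul _ _
  | succ n ih =>
    rw [tasepAfter, PMF.tsum_bind_mul, pow_succ, Module.End.mul_apply, ← ih]
    rfl

theorem pow_geomStep_backMap (n : ℕ) (f : Config → ℝ≥0∞) :
    (kernelOp (geomStep q hq0 hq1) ^ n) (kernelOp (backMap q hq1) f) Config.step =
      ∑ p ∈ Finset.HasAntidiagonal.antidiagonal n, (n.choose p.1 : ℝ≥0∞) * ((q : ℝ≥0∞) ^ p.1 *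
        (1 - q : ℝ≥0∞) ^ p.2 * (kernelOp (geomStep q hq0 hq1) ^ p.1) f Config.step) := by
  rw [← Module.End.mul_apply, ← ((semiconjBy_backMap q hq0 hq1).pow_right n).eq,
    Module.End.mul_apply, kernelOp_backMap_step,
    Commute.add_pow' (((Commute.one_right _).smul_right _).smul_left _), LinearMap.sum_apply,
    Finset.sum_apply]
  refine Finset.sum_congr rfl fun p _ => ?_
  simp [smul_pow, mul_assoc, mul_left_comm]

end GeomStep

/-! ### Thinning of a Poisson number -/

/-- Kept and discarded points of a thinned Poisson number are independent Poisson variables; summing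
over the discarded ones, `j`, then gives `tsum_poisson_mul_binomial`. -/
theorem poisson_mul_choose (m q : ℝ≥0) (hq : q ≤ 1) (i j : ℕ) :
    (ProbabilityTheory.poissonMeasure m).toPMF (i + j) *
        (((i + j).choose i : ℝ≥0∞) * ((q : ℝ≥0∞) ^ i * (1 - q : ℝ≥0∞) ^ j)) =
      (ProbabilityTheory.poissonMeasure (q * m)).toPMF i *
        (ProbabilityTheory.poissonMeasure ((1 - q) * m)).toPMF j := by
  have h1 : (((i + j).choose i : ℝ≥0∞) * ((q : ℝ≥0∞) ^ i * (1 - q : ℝ≥0∞) ^ j)) =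
      ENNReal.ofReal ((i + j).choose i * (q ^ i * (1 - q) ^ j)) := by
    have h2 : (0 : ℝ) ≤ 1 - q := sub_nonneg.2 hq
    rw [ENNReal.ofReal_mul (by positivity), ENNReal.ofReal_mul (by positivity),
      ENNReal.ofReal_pow (by positivity), ENNReal.ofReal_pow h2, ENNReal.ofReal_natCast,
      ENNReal.ofReal_coe_nnreal, ENNReal.ofReal_sub _ (by positivity), ENNReal.ofReal_one,
      ENNReal.ofReal_coe_nnreal]
  simp only [MeasureTheory.Measure.toPMF_apply, ProbabilityTheory.poissonMeasure_singleton]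
  rw [h1, ← ENNReal.ofReal_mul (by positivity), ← ENNReal.ofReal_mul (by positivity)]
  congr 1
  push_cast [NNReal.coe_sub hq]
  rw [Nat.cast_add_choose, show -(m : ℝ) = -(q * m) + -((1 - q) * m) by ring, Real.exp_add,
    mul_pow, mul_pow, pow_add]
  have := (i + j).factorial_ne_zero
  field_simp

theorem tsum_poisson_mul_binomial (m q : ℝ≥0) (hq : q ≤ 1) (a : ℕ → ℝ≥0∞) :
    ∑' n, (ProbabilityTheory.poissonMeasure m).toPMF n * ∑ p ∈ Finset.HasAntidiagonal.antidiagonal n,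
        (n.choose p.1 : ℝ≥0∞) * ((q : ℝ≥0∞) ^ p.1 * (1 - q : ℝ≥0∞) ^ p.2 * a p.1) =
      ∑' n, (ProbabilityTheory.poissonMeasure (q * m)).toPMF n * a n := by
  have h1 : ∀ n, (ProbabilityTheory.poissonMeasure m).toPMF n * ∑ p ∈ Finset.HasAntidiagonal.antidiagonal n,
        (n.choose p.1 : ℝ≥0∞) * ((q : ℝ≥0∞) ^ p.1 * (1 - q : ℝ≥0∞) ^ p.2 * a p.1) =
      ∑' p : Finset.HasAntidiagonal.antidiagonal n, (ProbabilityTheory.poissonMeasure (q * m)).toPMF p.1.1 *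
        a p.1.1 * (ProbabilityTheory.poissonMeasure ((1 - q) * m)).toPMF p.1.2 := fun n => by
    rw [Finset.tsum_subtype (Finset.HasAntidiagonal.antidiagonal n) fun p : ℕ × ℕ =>
      (ProbabilityTheory.poissonMeasure (q * m)).toPMF p.1 * a p.1 *
        (ProbabilityTheory.poissonMeasure ((1 - q) * m)).toPMF p.2, Finset.mul_sum]
    refine Finset.sum_congr rfl fun p hp => ?_
    rw [Finset.HasAntidiagonal.mem_antidiagonal] at hp
    rw [mul_right_comm _ (a p.1), ← poisson_mul_choose m q hq, hp]
    ring
  simp only [h1]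
  rw [← ENNReal.tsum_sigma' (f := fun p : Σ n : ℕ, Finset.HasAntidiagonal.antidiagonal n =>
    (ProbabilityTheory.poissonMeasure (q * m)).toPMF p.2.1.1 *
        a p.2.1.1 * (ProbabilityTheory.poissonMeasure ((1 - q) * m)).toPMF p.2.1.2),
    ← Finset.HasAntidiagonal.sigmaAntidiagonalEquivProd.symm.tsum_eq, ENNReal.tsum_prod']
  refine tsum_congr fun i => ?_
  simp only [Finset.HasAntidiagonal.sigmaAntidiagonalEquivProd_symm_apply_snd_coe]
  rw [ENNReal.tsum_mul_left, PMF.tsum_coe, mul_one]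

theorem mainTheorem3 (q : ℝ≥0) (hq0 : 0 < q) (hq1 : q < 1) (t : ℝ≥0) :
    (geomTasepLaw q hq0 hq1 t).bind (backMap q hq1) = geomTasepLaw q hq0 hq1 (q * t) := by
  classical
  ext y
  -- Testing against the indicator of `y` turns the identity of laws into one of operators at
  -- `Config.step`.
  have h1 : ∀ x, backMap q hq1 x y = kernelOp (backMap q hq1) (Pi.single y 1) x := fun x => by
    rw [← kernelOp_single]
  have h2 : ∀ p : PMF Config, p y = ∑' x, p x * (Pi.single y 1 : Config → ℝ≥0∞) x := fun p => by
    rw [tsum_eq_single y fun z hz => by simp [hz]]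
    simp
  rw [PMF.bind_apply, geomTasepLaw, geomTasepLaw, h2 (tasepLaw _ _ _ (q * t)), tasepLaw, tasepLaw,
    PMF.tsum_bind_mul, PMF.tsum_bind_mul]
  simp only [h1, tsum_tasepAfter_mul q hq0 hq1, pow_geomStep_backMap]
  simp only [mul_assoc q t]
  exact tsum_poisson_mul_binomial _ q hq1.le
    fun n => (kernelOp (geomStep q hq0 hq1) ^ n) (Pi.single y 1) Config.step
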